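/- For a finite lattice $M$ and $x\in M$, let $\mathsf{Pop}_M(x)$ be the meet of $x$ and all elements of $M$ covered by $x$, let $\mathscr{U}_M(x)$ be the set of elements of $M$ that cover $x$, and let $$\mathsf{Pop}(M;q)=\sum_{x\in \mathsf{Pop}_M(M)} q^{|\mathscr{U}_M(x)|}.$$ Let $B_n$ be the set of permutations $x=x_1x_2\cdots x_{2n}$ of $\{1,\dots,2n\}$ with $x_i+x_{2n+1-i}=2n+1$ for all $i$, and let $\mathrm{Weak}(B_n)$ be the right weak order on $B_n$, that is, the partial order in which $x\le y$ if and only if $y$ can be obtained from $x$ by a finite (possibly empty) sequence of moves of the following form: for some $1\le i\le n$ such that $i$ is an ascent ($x_i<x_{i+1}$), swap the entries in positions $i$ and $i+1$ and, if $i<n$, also the entries in positions $2n-i$ and $2n+1-i$. This partial order is a lattice. **Theorem.** For every $n\ge 1$, the coefficient of $q^{n-1}$ in $\mathsf{Pop}(\mathrm{Weak}(B_n);q)$ is $3^n-2n-1$. Equivalently, the number of $x\in\mathsf{Pop}_{\mathrm{Weak}(B_n)}(\mathrm{Weak}(B_n))$ with $|\mathscr{U}_{\mathrm{Weak}(B_n)}(x)|=n-1$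 is $3^n-2n-1$. -/

import Mathlib

namespace PopStack

/-! ### The pop-stack operator of a finite lattice -/

section Pop

variable {M : Type*}

open Classical in
/-- `Pop_M(x)`: the meet of `x` and all the elements of `M` that are covered by `x`. -/
noncomputable def pop [SemilatticeInf M] [Fintype M] (x : M) : M :=
  (insert x (Finset.univ.filter fun y => y ⋖ x)).inf' (Finset.insert_nonempty _ _) id

/-- `𝒰_M(x)`: the set of the elements of `M` that cover `x`. -/
def upperCovers [PartialOrder M] (x : M) : Set M := {y | x ⋖ y}

open Classical in
/-- The generating polynomial `Pop(M; q) = ∑_{x ∈ Pop_M(M)} q ^ |𝒰_M(x)|`. -/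
noncomputable def popPolynomial (M : Type*) [SemilatticeInf M] [Fintype M] : Polynomial ℤ :=
  ∑ x ∈ Finset.univ.image (pop : M → M), Polynomial.X ^ (upperCovers x).ncard

end Pop

/-! ### The weak order of type `B` -/

/-- The hyperoctahedral group `B_n` as a set: the permutations `x₁ x₂ ⋯ x₂ₙ` of `{1, …, 2n}` with
`x_i + x_{2n+1-i} = 2n+1`. Positions and values are shifted down by one, to `Fin (2 * n)`, where
the condition reads `x (rev i) = rev (x i)`. -/
def WeakB (n : ℕ) : Type :=
  {x : Equiv.Perm (Fin (2 * n)) // ∀ i, x i.rev = (x i).rev}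

namespace WeakB

variable {n : ℕ}

instance : Fintype (WeakB n) :=
  inferInstanceAs (Fintype {x : Equiv.Perm (Fin (2 * n)) // ∀ i, x i.rev = (x i).rev})

/-- The position `i`, for `i < n` (zero-based). -/
def left (i : Fin n) : Fin (2 * n) := ⟨i, by omega⟩

/-- The position `i + 1`, for `i < n` (zero-based). -/
def right (i : Fin n) : Fin (2 * n) := ⟨i + 1, by omega⟩

/-- The `n` simple reflections of `B_n`: the reflection with index `n - 1` swaps the two middle
positions `n - 1` and `n`; the one with index `i < n - 1` swaps the positions `i` and `i + 1`, and
their mirror images. -/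
def simpleReflection (i : Fin n) : Equiv.Perm (Fin (2 * n)) :=
  if (i : ℕ) + 1 = n then Equiv.swap (left i) (right i)
  else Equiv.swap (left i) (right i) * Equiv.swap (left i).rev (right i).rev

/-- `y` arises from `x` by applying to the positions a simple reflection at an ascent of `x`. -/
def AscentStep (x y : WeakB n) : Prop :=
  ∃ i : Fin n, x.1 (left i) < x.1 (right i) ∧ y.1 = x.1 * simpleReflection i

/-- The right weak order of type `B_n`: `x ≤ y` if `y` can be reached from `x` by finitely many
(possibly no) ascent steps. -/
instance : LE (WeakB n) := ⟨Relation.ReflTransGen AscentStep⟩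

/-! #### The weak order is containment of inversion sets -/

/-- The values `a < b` form an inversion of `x`: the larger one stands to the left. -/
def Inv (x : WeakB n) (a b : Fin (2 * n)) : Prop := a < b ∧ x.1.symm b < x.1.symm a

theorem simpleReflection_val (i : Fin n) (u : Fin (2 * n)) :
    (simpleReflection i u : ℕ) =
      if (u : ℕ) = i then (i : ℕ) + 1 else if (u : ℕ) = i + 1 then (i : ℕ)
      else if (u : ℕ) + i + 1 = 2 * n then 2 * n - ((i : ℕ) + 2)
      else if (u : ℕ) + i + 2 = 2 * n then 2 * n - ((i : ℕ) + 1) else (u : ℕ) := by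
  have hi := i.2
  have hu := u.2
  unfold simpleReflection
  split_ifs <;>
  simp only [Equiv.Perm.mul_apply, Equiv.swap_apply_def, left, right, Fin.ext_iff, Fin.val_rev] <;>
  (try split_ifs) <;> simp_all [Fin.val_rev] <;> omega

theorem simpleReflection_invol (i : Fin n) (u : Fin (2 * n)) :
    simpleReflection i (simpleReflection i u) = u := by
  have hi := i.2
  have hu := u.2
  apply Fin.ext
  rw [simpleReflection_val i (simpleReflection i u), simpleReflection_val i u]
  split_ifs <;> omega

theorem simpleReflection_symm (i : Fin n) (u : Fin (2 * n)) :
    (simpleReflection i).symm u = simpleReflection i u := by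
  rw [Equiv.symm_apply_eq, simpleReflection_invol]

theorem simpleReflection_rev (i : Fin n) (u : Fin (2 * n)) :
    simpleReflection i u.rev = (simpleReflection i u).rev := by
  have hi := i.2
  have hu := u.2
  apply Fin.ext
  rw [Fin.val_rev, simpleReflection_val i u, simpleReflection_val i u.rev, Fin.val_rev]
  split_ifs <;> omega

theorem simpleReflection_left (i : Fin n) : simpleReflection i (left i) = right i := by
  apply Fin.ext
  rw [simpleReflection_val]
  simp [left, right]

theorem simpleReflection_right (i : Fin n) : simpleReflection i (right i) = left i := by
  rw [← simpleReflection_left, simpleReflection_invol]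

theorem simpleReflection_lt (i : Fin n) {u v : Fin (2 * n)} (h : u < v) :
    simpleReflection i u < simpleReflection i v ∨ (u = left i ∧ v = right i) ∨
      (u = (right i).rev ∧ v = (left i).rev) := by
  have hi := i.2
  have hu := u.2
  have hv := v.2
  simp only [Fin.lt_def, Fin.ext_iff, Fin.val_rev, left, right] at h ⊢
  rw [simpleReflection_val i u, simpleReflection_val i v]
  split_ifs <;> omega

theorem symm_rev (x : WeakB n) (a : Fin (2 * n)) : x.1.symm a.rev = (x.1.symm a).rev := by
  rw [Equiv.symm_apply_eq, x.2, Equiv.apply_symm_apply]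

theorem Inv.rev {x : WeakB n} {a b : Fin (2 * n)} (h : Inv x a b) : Inv x b.rev a.rev := by
  refine ⟨Fin.rev_lt_rev.2 h.1, ?_⟩
  rw [symm_rev, symm_rev]
  exact Fin.rev_lt_rev.2 h.2

theorem inv_of_step {x y : WeakB n} (h : AscentStep x y) {a b : Fin (2 * n)} (hab : Inv x a b) :
    Inv y a b := by
  obtain ⟨i, hi, hy⟩ := h
  refine ⟨hab.1, ?_⟩
  have key : ∀ c, y.1.symm c = simpleReflection i (x.1.symm c) := by
    intro c
    rw [Equiv.symm_apply_eq, hy, Equiv.Perm.mul_apply, simpleReflection_invol,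
      Equiv.apply_symm_apply]
  rw [key, key]
  rcases simpleReflection_lt i hab.2 with h | ⟨h1, h2⟩ | ⟨h1, h2⟩
  · exact h
  · rw [Equiv.symm_apply_eq] at h1 h2
    rw [← h1, ← h2] at hi
    exact absurd hi hab.1.asymm
  · rw [Equiv.symm_apply_eq, x.2] at h1 h2
    have := hab.1
    rw [h1, h2, Fin.rev_lt_rev] at this
    exact absurd hi this.asymm

theorem perm_eq_of_strictMono {N : ℕ} (x y : Equiv.Perm (Fin N))
    (h : StrictMono fun p => y.symm (x p)) : x = y := by
  have h2 : (fun p => y.symm (x p)) = id := by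
    let e : Fin N ≃o Fin N := h.orderIsoOfSurjective _ ((x.trans y.symm).surjective)
    have : e = OrderIso.refl _ := Subsingleton.elim _ _
    funext p
    exact congrArg (fun f : Fin N ≃o Fin N => f p) this
  ext p
  have := congrFun h2 p
  simp only [id, Equiv.symm_apply_eq] at this
  rw [this]

/-- Two elements, one with more inversions than the other, are equal or the smaller one has an
ascent that is an inversion of the larger one. -/
theorem exists_ascent {x y : WeakB n} (h : ∀ a b, Inv x a b → Inv y a b) (hne : x ≠ y) :
    ∃ i : Fin n, Inv y (x.1 (left i)) (x.1 (right i)) := by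
  by_contra hcon
  push Not at hcon
  apply hne
  apply Subtype.ext
  apply perm_eq_of_strictMono
  have adj : ∀ i : Fin n, y.1.symm (x.1 (left i)) < y.1.symm (x.1 (right i)) := by
    intro i
    have hlr : left i < right i := by simp [Fin.lt_def, left, right]
    rcases lt_trichotomy (x.1 (left i)) (x.1 (right i)) with h1 | h1 | h1
    · have h2 : ¬ y.1.symm (x.1 (right i)) < y.1.symm (x.1 (left i)) := fun h3 => hcon i ⟨h1, h3⟩
      refine lt_of_le_of_ne (not_lt.1 h2) fun h3 => ?_
      exact h1.ne (y.1.symm.injective h3)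
    · exact absurd (x.1.injective h1) hlr.ne
    · exact (h _ _ ⟨h1, by simpa using hlr⟩).2
  have step : ∀ p q : Fin (2 * n), (q : ℕ) = p + 1 → y.1.symm (x.1 p) < y.1.symm (x.1 q) := by
    intro p q hpq
    have hq := q.2
    by_cases hp : (p : ℕ) < n
    · have e1 : p = left ⟨p, hp⟩ := by simp [left]
      have e2 : q = right ⟨p, hp⟩ := by simp [right, Fin.ext_iff, hpq]
      rw [e1, e2]
      exact adj _
    · have hp' : 2 * n - (p + 2) < n := by omega
      have e1 : p = (right ⟨2 * n - (p + 2), hp'⟩).rev := by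
        simp only [right, Fin.ext_iff, Fin.val_rev]; omega
      have e2 : q = (left ⟨2 * n - (p + 2), hp'⟩).rev := by
        simp only [left, Fin.ext_iff, Fin.val_rev]; omega
      rw [e1, e2, x.2, x.2, symm_rev, symm_rev, Fin.rev_lt_rev]
      exact adj _
  have main : ∀ (k : ℕ) (p q : Fin (2 * n)), (q : ℕ) = p + 1 + k →
      y.1.symm (x.1 p) < y.1.symm (x.1 q) := by
    intro k
    induction k with
    | zero => exact fun p q hpq => step p q (by omega)
    | succ k ih =>
      intro p q hpq
      have hq := q.2
      exact (ih p ⟨p + 1 + k, by omega⟩ rfl).trans (step _ q (by simp only; omega))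
  intro p q hpq
  have hpq' : (p : ℕ) < q := hpq
  exact main (q - p - 1) p q (by omega)

theorem le_of_inv (x y : WeakB n) (h : ∀ a b, Inv x a b → Inv y a b) : x ≤ y := by
  classical
  induction hm : (Finset.univ.filter fun c : Fin (2 * n) × Fin (2 * n) =>
    Inv y c.1 c.2 ∧ ¬ Inv x c.1 c.2).card using Nat.strong_induction_on generalizing x with
  | _ m ih =>
    by_cases hne : x = y
    · rw [hne]
      exact Relation.ReflTransGen.refl
    obtain ⟨i, hi⟩ := exists_ascent h hne
    let x' : WeakB n := ⟨x.1 * simpleReflection i, fun u => by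
      rw [Equiv.Perm.mul_apply, Equiv.Perm.mul_apply, simpleReflection_rev, x.2]⟩
    have hstep : AscentStep x x' := ⟨i, hi.1, rfl⟩
    have key : ∀ c, x'.1.symm c = simpleReflection i (x.1.symm c) := by
      intro c
      rw [Equiv.symm_apply_eq, Equiv.Perm.mul_apply, simpleReflection_invol,
        Equiv.apply_symm_apply]
    have h' : ∀ a b, Inv x' a b → Inv y a b := by
      intro a b hab
      have hab2 := hab.2
      rw [key, key] at hab2
      rcases simpleReflection_lt i hab2 with h1 | ⟨h1, h2⟩ | ⟨h1, h2⟩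
      · rw [simpleReflection_invol, simpleReflection_invol] at h1
        exact h _ _ ⟨hab.1, h1⟩
      · have e1 := congrArg (simpleReflection i) h1
        have e2 := congrArg (simpleReflection i) h2
        rw [simpleReflection_invol, simpleReflection_left, Equiv.symm_apply_eq] at e1
        rw [simpleReflection_invol, simpleReflection_right, Equiv.symm_apply_eq] at e2
        rw [e1, e2]
        exact hi
      · have e1 := congrArg (simpleReflection i) h1
        have e2 := congrArg (simpleReflection i) h2
        rw [simpleReflection_invol, simpleReflection_rev, simpleReflection_right,
          Equiv.symm_apply_eq, x.2] at e1
        rw [simpleReflection_invol, simpleReflection_rev, simpleReflection_left,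
          Equiv.symm_apply_eq, x.2] at e2
        rw [e1, e2]
        exact hi.rev
    refine Relation.ReflTransGen.head hstep (ih _ ?_ x' h' rfl)
    rw [← hm]
    apply Finset.card_lt_card
    refine ⟨fun c hc => ?_, fun hsub => ?_⟩
    · simp only [Finset.mem_filter, Finset.mem_univ, true_and] at hc ⊢
      exact ⟨hc.1, fun h2 => hc.2 (inv_of_step hstep h2)⟩
    · have hmem : (x.1 (left i), x.1 (right i)) ∈ Finset.univ.filter
          fun c : Fin (2 * n) × Fin (2 * n) => Inv y c.1 c.2 ∧ ¬ Inv x c.1 c.2 := by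
        simp only [Finset.mem_filter, Finset.mem_univ, true_and]
        refine ⟨hi, fun h2 => ?_⟩
        have := h2.2
        simp [left, right, Fin.lt_def] at this
      have h3 := hsub hmem
      simp only [Finset.mem_filter, Finset.mem_univ, true_and] at h3
      apply h3.2
      refine ⟨hi.1, ?_⟩
      rw [key, key, Equiv.symm_apply_apply, Equiv.symm_apply_apply, simpleReflection_left,
        simpleReflection_right]
      simp [left, right, Fin.lt_def]

/-- In the weak order, `x ≤ y` if and only if every inversion of `x` is an inversion of `y`. -/
theorem le_iff (x y : WeakB n) : x ≤ y ↔ ∀ a b, Inv x a b → Inv y a b := by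
  refine ⟨fun h => ?_, le_of_inv x y⟩
  change Relation.ReflTransGen AscentStep x y at h
  induction h with
  | refl => exact fun a b h => h
  | tail _ hs ih => exact fun a b h => inv_of_step hs (ih a b h)

theorem eq_of_inv {x y : WeakB n} (h : ∀ a b, Inv x a b ↔ Inv y a b) : x = y := by
  by_contra hne
  obtain ⟨i, hi⟩ := exists_ascent (fun a b => (h a b).1) hne
  have := ((h _ _).2 hi).2
  simp [left, right, Fin.lt_def] at this

instance : PartialOrder (WeakB n) where
  le_refl _ := Relation.ReflTransGen.refl
  le_trans _ _ _ := Relation.ReflTransGen.trans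
  le_antisymm x y h1 h2 :=
    eq_of_inv fun a b => ⟨(le_iff x y).1 h1 a b, (le_iff y x).1 h2 a b⟩

/-! #### The weak order is a lattice -/

/-- Pairs of values `a < b` that do not form an inversion in `x`, or do not in `y`. -/
def NonInv (x y : WeakB n) (a b : Fin (2 * n)) : Prop :=
  a < b ∧ (x.1.symm a < x.1.symm b ∨ y.1.symm a < y.1.symm b)

/-- The order in which the values appear in the meet of `x` and `y`. -/
def meetRel (x y : WeakB n) (a b : Fin (2 * n)) : Prop :=
  Relation.TransGen (NonInv x y) a b ∨ (b < a ∧ ¬ Relation.TransGen (NonInv x y) b a)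

theorem transGen_lt {x y : WeakB n} {a b : Fin (2 * n)}
    (h : Relation.TransGen (NonInv x y) a b) : a < b := by
  induction h with
  | single h => exact h.1
  | tail _ h ih => exact ih.trans h.1

theorem transGen_split {x y : WeakB n} {a c : Fin (2 * n)}
    (h : Relation.TransGen (NonInv x y) a c) : ∀ b, a < b → b < c →
      Relation.TransGen (NonInv x y) a b ∨ Relation.TransGen (NonInv x y) b c := by
  have base : ∀ a b c, a < b → b < c → NonInv x y a c → NonInv x y a b ∨ NonInv x y b c := by
    intro a b c hab hbc h
    rcases h.2 with h | h
    · rcases lt_or_ge (x.1.symm a) (x.1.symm b) with h1 | h1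
      · exact Or.inl ⟨hab, Or.inl h1⟩
      · exact Or.inr ⟨hbc, Or.inl (h1.trans_lt h)⟩
    · rcases lt_or_ge (y.1.symm a) (y.1.symm b) with h1 | h1
      · exact Or.inl ⟨hab, Or.inr h1⟩
      · exact Or.inr ⟨hbc, Or.inr (h1.trans_lt h)⟩
  induction h with
  | single h =>
    intro b hab hbc
    exact (base _ _ _ hab hbc h).imp .single .single
  | @tail d c had hdc ih =>
    intro b hab hbc
    rcases lt_trichotomy b d with hbd | hbd | hbd
    · exact (ih b hab hbd).imp id fun h => h.tail hdc
    · exact Or.inl (hbd ▸ had)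
    · exact (base _ _ _ hbd hbc hdc).imp (fun h => had.tail h) .single

theorem transGen_rev {x y : WeakB n} {a b : Fin (2 * n)}
    (h : Relation.TransGen (NonInv x y) a b) :
    Relation.TransGen (NonInv x y) b.rev a.rev := by
  have base : ∀ a b, NonInv x y a b → NonInv x y b.rev a.rev := by
    intro a b h
    refine ⟨Fin.rev_lt_rev.2 h.1, ?_⟩
    rw [symm_rev, symm_rev, symm_rev, symm_rev, Fin.rev_lt_rev, Fin.rev_lt_rev]
    exact h.2
  induction h with
  | single h => exact .single (base _ _ h)
  | tail _ h ih => exact .head (base _ _ h) ih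

theorem meetRel_rev {x y : WeakB n} {a b : Fin (2 * n)} (h : meetRel x y a b) :
    meetRel x y b.rev a.rev := by
  rcases h with h | ⟨h1, h2⟩
  · exact Or.inl (transGen_rev h)
  · refine Or.inr ⟨Fin.rev_lt_rev.2 h1, fun h => h2 ?_⟩
    simpa using transGen_rev h

theorem meetRel_irrefl (x y : WeakB n) (a : Fin (2 * n)) : ¬ meetRel x y a a := by
  rintro (h | h)
  · exact (transGen_lt h).false
  · exact h.1.false

theorem meetRel_total (x y : WeakB n) {a b : Fin (2 * n)} (h : a ≠ b) :
    meetRel x y a b ∨ meetRel x y b a := by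
  unfold meetRel
  rcases lt_or_gt_of_ne h with h | h <;> tauto

theorem meetRel_trans {x y : WeakB n} {a b c : Fin (2 * n)} (h1 : meetRel x y a b)
    (h2 : meetRel x y b c) : meetRel x y a c := by
  rcases h1 with h1 | ⟨h1, h1'⟩ <;> rcases h2 with h2 | ⟨h2, h2'⟩
  · exact Or.inl (h1.trans h2)
  · have hab := transGen_lt h1
    rcases lt_trichotomy a c with h | h | h
    · exact Or.inl ((transGen_split h1 c h h2).resolve_right h2')
    · exact absurd (h ▸ h1) h2'
    · exact Or.inr ⟨h, fun h3 => h2' (h3.trans h1)⟩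
  · have hbc := transGen_lt h2
    rcases lt_trichotomy a c with h | h | h
    · exact Or.inl ((transGen_split h2 a h1 h).resolve_left h1')
    · exact absurd (h ▸ h2) h1'
    · exact Or.inr ⟨h, fun h3 => h1' (h2.trans h3)⟩
  · refine Or.inr ⟨h2.trans h1, fun h3 => ?_⟩
    rcases transGen_split h3 b h2 h1 with h | h
    · exact h2' h
    · exact h1' h

open Classical in
/-- The position of the value `a` in the meet of `x` and `y`. -/
noncomputable def meetPos (x y : WeakB n) (a : Fin (2 * n)) : ℕ :=
  (Finset.univ.filter fun b => meetRel x y b a).card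

theorem meetPos_lt_of {x y : WeakB n} {a b : Fin (2 * n)} (h : meetRel x y a b) :
    meetPos x y a < meetPos x y b := by
  classical
  apply Finset.card_lt_card
  refine ⟨fun c hc => ?_, fun hsub => ?_⟩
  · simp only [Finset.mem_filter, Finset.mem_univ, true_and] at hc ⊢
    exact meetRel_trans hc h
  · have := hsub (Finset.mem_filter.2 ⟨Finset.mem_univ a, h⟩)
    simp only [Finset.mem_filter, Finset.mem_univ, true_and] at this
    exact meetRel_irrefl x y a this

theorem meetPos_rev (x y : WeakB n) (a : Fin (2 * n)) :
    meetPos x y a.rev + meetPos x y a + 1 = 2 * n := by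
  classical
  have h1 : meetPos x y a.rev = (Finset.univ.filter fun b => meetRel x y a b).card := by
    unfold meetPos
    refine Finset.card_bij' (fun b _ => b.rev) (fun b _ => b.rev) ?_ ?_ (by simp) (by simp)
    · intro b hb
      simp only [Finset.mem_filter, Finset.mem_univ, true_and] at hb ⊢
      simpa using meetRel_rev hb
    · intro b hb
      simp only [Finset.mem_filter, Finset.mem_univ, true_and] at hb ⊢
      exact meetRel_rev hb
  have h2 : (Finset.univ : Finset (Fin (2 * n))) =
      insert a ((Finset.univ.filter fun b => meetRel x y a b) ∪
        (Finset.univ.filter fun b => meetRel x y b a)) := by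
    ext b
    simp only [Finset.mem_univ, Finset.mem_insert, Finset.mem_union, Finset.mem_filter, true_and,
      true_iff]
    by_cases hb : b = a
    · exact Or.inl hb
    · exact Or.inr (meetRel_total x y (Ne.symm hb))
  have h3 := congrArg Finset.card h2
  rw [Finset.card_insert_of_notMem (by simp [meetRel_irrefl]), Finset.card_union_of_disjoint,
    Finset.card_univ, Fintype.card_fin] at h3
  · rw [h1]
    unfold meetPos
    exact h3.symm
  · rw [Finset.disjoint_filter]
    exact fun b _ h4 h5 => meetRel_irrefl x y a (meetRel_trans h4 h5)

/-- The meet of `x` and `y`, as the bijection that sends a value to its position. -/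
noncomputable def meetEquiv (x y : WeakB n) : Equiv.Perm (Fin (2 * n)) :=
  Equiv.ofBijective
    (fun a => (⟨meetPos x y a, by have := meetPos_rev x y a; omega⟩ : Fin (2 * n)))
    (Finite.injective_iff_bijective.1 fun a b h => by
      by_contra hne
      have h' : meetPos x y a = meetPos x y b := congrArg Fin.val h
      rcases meetRel_total x y hne with h1 | h1
      · exact (meetPos_lt_of h1).ne h'
      · exact (meetPos_lt_of h1).ne' h')

/-- The meet of `x` and `y` in the weak order. -/
noncomputable def meet (x y : WeakB n) : WeakB n :=
  ⟨(meetEquiv x y).symm, fun i => by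
    rw [Equiv.symm_apply_eq]
    apply Fin.ext
    have h := meetPos_rev x y ((meetEquiv x y).symm i)
    have h1 : meetPos x y ((meetEquiv x y).symm i) = i :=
      congrArg Fin.val ((meetEquiv x y).apply_symm_apply i)
    change _ = meetPos x y _
    rw [Fin.val_rev]
    omega⟩

theorem meet_symm_lt {x y : WeakB n} {a b : Fin (2 * n)} :
    (meet x y).1.symm a < (meet x y).1.symm b ↔ meetRel x y a b := by
  have h0 : ∀ c, ((meet x y).1.symm c : ℕ) = meetPos x y c := fun _ => rfl
  rw [Fin.lt_def, h0, h0]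
  refine ⟨fun h => ?_, meetPos_lt_of⟩
  have hne : a ≠ b := by
    rintro rfl
    exact h.false
  exact (meetRel_total x y hne).resolve_right fun h1 => h.asymm (meetPos_lt_of h1)

theorem inv_meet {x y : WeakB n} {a b : Fin (2 * n)} :
    Inv (meet x y) a b ↔ a < b ∧ ¬ Relation.TransGen (NonInv x y) a b := by
  unfold Inv
  rw [meet_symm_lt]
  refine and_congr_right fun h => ⟨?_, fun h1 => Or.inr ⟨h, h1⟩⟩
  rintro (h1 | h1)
  · exact absurd (transGen_lt h1) h.asymm
  · exact h1.2

theorem inv_iff {x : WeakB n} {a b : Fin (2 * n)} :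
    Inv x a b ↔ a < b ∧ ¬ x.1.symm a < x.1.symm b := by
  refine and_congr_right fun h => ?_
  rw [not_lt]
  exact ⟨le_of_lt, fun h1 => lt_of_le_of_ne h1 fun h2 => h.ne (x.1.symm.injective h2).symm⟩

noncomputable instance : SemilatticeInf (WeakB n) where
  inf := meet
  inf_le_left x y := by
    rw [le_iff]
    intro a b h
    rw [inv_meet] at h
    rw [inv_iff]
    exact ⟨h.1, fun h1 => h.2 (.single ⟨h.1, Or.inl h1⟩)⟩
  inf_le_right x y := by
    rw [le_iff]
    intro a b h
    rw [inv_meet] at h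
    rw [inv_iff]
    exact ⟨h.1, fun h1 => h.2 (.single ⟨h.1, Or.inr h1⟩)⟩
  le_inf z x y hx hy := by
    rw [le_iff] at hx hy ⊢
    intro a b h
    rw [inv_meet]
    refine ⟨h.1, fun ht => ?_⟩
    have key : z.1.symm a < z.1.symm b := by
      clear h
      have base : ∀ c d, NonInv x y c d → z.1.symm c < z.1.symm d := by
        intro c d hcd
        by_contra hz
        have hz' : Inv z c d := inv_iff.2 ⟨hcd.1, hz⟩
        rcases hcd.2 with h1 | h1
        · exact h1.asymm (hx _ _ hz').2
        · exact h1.asymm (hy _ _ hz').2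
      induction ht with
      | single h => exact base _ _ h
      | tail _ h ih => exact ih.trans (base _ _ h)
    exact key.asymm h.2

end WeakB

end PopStack

/-!
An element of `B_n` with `n - 1` upper covers has exactly one descent, at some `i ≤ n`. Such an
element is increasing on the first `i` positions, on the last `i` positions, and on those in between.
Recording for every value the block in which it stands (`-1`, `0` or `1` for the first, the middle
and the last block) gives an odd function `g : Fin (2 * n) → SignType`, that is,
`g v.rev = -g v`, and the element is the stable sort of the values by `g` (`sortOdd`). Its inversions
are the pairs `a < b` with `g b < g a`. So the elements with one descent correspond to the odd
functions that are not monotone (`existsUnique_descent_sortOdd`, `eq_of_sortOdd_eq`,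
`exists_sortOdd_eq`).

Which of them are in the image of the pop-stack operator? Let `x` be obtained from the stable sort by
reversing every block. If `g` is not antitone, then `x` has no descent between blocks, so all
elements covered by `x` lie above the stable sort, whereas a common lower bound of them is increasing
on every block; hence `pop x` is the stable sort (`pop_revSortOdd`). If `g` is antitone, all pairs
from different blocks are inversions of the stable sort. Every `x` above it has the same blocks and a
descent between two of them, and removing this descent gives an element covered by `x` that is not
above the stable sort; hence the stable sort is not `pop x` (`sortOdd_notMem_range_pop`).

There are `3 ^ n` odd functions. The monotone ones are the `n + 1` block structures of the positions,
their negatives are the `n + 1` antitone ones, and only the zero function is both. This leaves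
`3 ^ n - (2 * n + 1)`.
-/

namespace PopStack

/-- Elements below `pop x` are the common lower bounds of `x` and the elements it covers. -/
theorem le_pop_iff {M : Type*} [SemilatticeInf M] [Fintype M] {x z : M} :
    z ≤ pop x ↔ z ≤ x ∧ ∀ y, y ⋖ x → z ≤ y := by
  simp [pop, Finset.le_inf'_iff]

namespace WeakB

variable {n : ℕ}

/-! ### Covers in the weak order -/

/-- The element `x s_i`: the simple reflection with index `i` applied to the positions of `x`. -/
def mulSimple (x : WeakB n) (i : Fin n) : WeakB n :=
  ⟨x.1 * simpleReflection i, fun u => by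
    rw [Equiv.Perm.mul_apply, Equiv.Perm.mul_apply, simpleReflection_rev, x.2]⟩

theorem mulSimple_left (x : WeakB n) (i : Fin n) : (x.mulSimple i).1 (left i) = x.1 (right i) :=
  congrArg x.1 (simpleReflection_left i)

theorem mulSimple_right (x : WeakB n) (i : Fin n) : (x.mulSimple i).1 (right i) = x.1 (left i) :=
  congrArg x.1 (simpleReflection_right i)

theorem mulSimple_mulSimple (x : WeakB n) (i : Fin n) : (x.mulSimple i).mulSimple i = x :=
  Subtype.ext <| Equiv.ext fun u => congrArg x.1 (simpleReflection_invol i u)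

theorem mulSimple_symm (x : WeakB n) (i : Fin n) (a : Fin (2 * n)) :
    (x.mulSimple i).1.symm a = simpleReflection i (x.1.symm a) := by
  rw [Equiv.symm_apply_eq]
  change a = x.1 (simpleReflection i (simpleReflection i (x.1.symm a)))
  rw [simpleReflection_invol, Equiv.apply_symm_apply]

theorem left_lt_right (i : Fin n) : left i < right i := by
  simp [Fin.lt_def, left, right]

theorem mulSimple_injective (x : WeakB n) : Function.Injective x.mulSimple := by
  intro i j h
  have h1 : simpleReflection i = simpleReflection j := mul_left_cancel (congrArg Subtype.val h)
  have h2 := congrArg (fun s => ((s (left i) : Fin (2 * n)) : ℕ)) h1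
  have hi := i.2
  have hj := j.2
  simp only [simpleReflection_val, left] at h2
  apply Fin.ext
  split_ifs at h2 <;> omega

/-- Passing from `x` to `x s_i` destroys at most the inversion at the positions of `s_i` and its
mirror image. -/
theorem inv_mulSimple_of_inv {x : WeakB n} {i : Fin n} {a b : Fin (2 * n)} (h : Inv x a b) :
    Inv (x.mulSimple i) a b ∨ (a = x.1 (right i) ∧ b = x.1 (left i)) ∨
      (a = (x.1 (left i)).rev ∧ b = (x.1 (right i)).rev) := by
  rcases simpleReflection_lt i h.2 with h1 | ⟨h1, h2⟩ | ⟨h1, h2⟩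
  · left
    refine ⟨h.1, ?_⟩
    rwa [mulSimple_symm, mulSimple_symm]
  · rw [Equiv.symm_apply_eq] at h1 h2
    exact Or.inr (Or.inl ⟨h2, h1⟩)
  · rw [Equiv.symm_apply_eq, x.2] at h1 h2
    exact Or.inr (Or.inr ⟨h2, h1⟩)

theorem lt_of_ascentStep {x y : WeakB n} (h : AscentStep x y) : x < y := by
  refine lt_of_le_of_ne (Relation.ReflTransGen.single h) ?_
  rintro rfl
  obtain ⟨i, hi, hx⟩ := h
  have h1 : x.1 (left i) = x.1 (right i) := by
    conv_lhs => rw [hx]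
    rw [Equiv.Perm.mul_apply, simpleReflection_left]
  exact hi.ne h1

theorem covBy_mulSimple {x : WeakB n} {i : Fin n} (hi : x.1 (left i) < x.1 (right i)) :
    x ⋖ x.mulSimple i := by
  refine ⟨lt_of_ascentStep ⟨i, hi, rfl⟩, fun z hxz hzy => ?_⟩
  rcases Relation.ReflTransGen.cases_head (show Relation.ReflTransGen AscentStep x z from hxz.le)
    with h | ⟨w, hw, hwz⟩
  · exact hxz.ne h
  -- The first step towards `z` is at an ascent `j` that is an inversion of `x s_i`, so `j = i`.
  obtain ⟨j, hj, hwj⟩ := hw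
  have hw' : w = x.mulSimple j := Subtype.ext hwj
  subst hw'
  have h1 : Inv (x.mulSimple j) (x.1 (left j)) (x.1 (right j)) := by
    refine ⟨hj, ?_⟩
    rw [← mulSimple_left, Equiv.symm_apply_apply, ← mulSimple_right, Equiv.symm_apply_apply]
    exact left_lt_right j
  have h2 := ((le_iff _ _).1 (le_trans hwz hzy.le) _ _ h1).2
  rw [mulSimple_symm, mulSimple_symm, Equiv.symm_apply_apply, Equiv.symm_apply_apply] at h2
  have hij : j = i := by
    rcases simpleReflection_lt i h2 with h3 | ⟨h3, -⟩ | ⟨h3, -⟩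
    · rw [simpleReflection_invol, simpleReflection_invol] at h3
      exact absurd h3 (left_lt_right j).asymm
    · have h4 : right j = right i := by
        rw [← simpleReflection_invol i (right j), h3, simpleReflection_left]
      have h5 := congrArg Fin.val h4
      simp only [right] at h5
      exact Fin.ext (by omega)
    · have h4 : right j = (left i).rev := by
        rw [← simpleReflection_invol i (right j), h3, simpleReflection_rev, simpleReflection_right]
      have h5 := congrArg Fin.val h4
      have hi := i.2
      have hj := j.2
      simp only [right, left, Fin.val_rev] at h5
      exact Fin.ext (by omega)
  subst hij
  exact (lt_of_le_of_lt hwz hzy).false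

theorem covBy_iff {x y : WeakB n} :
    x ⋖ y ↔ ∃ i, x.1 (left i) < x.1 (right i) ∧ y = x.mulSimple i := by
  constructor
  · intro h
    rcases Relation.ReflTransGen.cases_head (show Relation.ReflTransGen AscentStep x y from h.le)
      with h1 | ⟨w, hw, hwy⟩
    · exact absurd h1 h.lt.ne
    have h2 : w = y := by
      by_contra hne
      exact h.2 (lt_of_ascentStep hw) (lt_of_le_of_ne hwy hne)
    obtain ⟨i, hi, hwi⟩ := hw
    exact ⟨i, hi, h2 ▸ Subtype.ext hwi⟩
  · rintro ⟨i, hi, rfl⟩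
    exact covBy_mulSimple hi

theorem mulSimple_covBy {x : WeakB n} {i : Fin n} (hi : x.1 (right i) < x.1 (left i)) :
    x.mulSimple i ⋖ x := by
  refine covBy_iff.2 ⟨i, ?_, (mulSimple_mulSimple x i).symm⟩
  rwa [mulSimple_left, mulSimple_right]

theorem exists_of_covBy {x z : WeakB n} (h : z ⋖ x) :
    ∃ i, x.1 (right i) < x.1 (left i) ∧ z = x.mulSimple i := by
  obtain ⟨i, hi, rfl⟩ := covBy_iff.1 h
  refine ⟨i, ?_, (mulSimple_mulSimple z i).symm⟩
  rwa [mulSimple_left, mulSimple_right]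

theorem ncard_upperCovers (x : WeakB n) :
    (upperCovers x).ncard = (Finset.univ.filter fun i => x.1 (left i) < x.1 (right i)).card := by
  have h : upperCovers x =
      x.mulSimple '' ↑(Finset.univ.filter fun i => x.1 (left i) < x.1 (right i)) := by
    ext y
    simp only [upperCovers, Set.mem_ofPred_eq, covBy_iff, Set.mem_image, Finset.coe_filter,
      Finset.mem_univ, true_and, eq_comm (a := y)]
  rw [h, Set.ncard_image_of_injective _ x.mulSimple_injective, Set.ncard_coe_finset]

/-- An element has `n - 1` upper covers if and only if it has exactly one descent. -/
theorem ncard_upperCovers_eq_sub_one_iff (hn : 1 ≤ n) (x : WeakB n) :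
    (upperCovers x).ncard = n - 1 ↔ ∃! i, x.1 (right i) < x.1 (left i) := by
  have h1 := Finset.card_filter_add_card_filter_not (s := Finset.univ)
    fun i => x.1 (left i) < x.1 (right i)
  have h2 : (Finset.univ.filter fun i => ¬ x.1 (left i) < x.1 (right i)) =
      Finset.univ.filter fun i => x.1 (right i) < x.1 (left i) := by
    refine Finset.filter_congr fun i _ => ?_
    rw [not_lt]
    exact ⟨fun h => lt_of_le_of_ne h fun h3 => (left_lt_right i).ne (x.1.injective h3).symm,
      le_of_lt⟩
  rw [h2, Finset.card_univ, Fintype.card_fin] at h1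
  have h3 : (upperCovers x).ncard = n - 1 ↔
      (Finset.univ.filter fun i => x.1 (right i) < x.1 (left i)).card = 1 := by
    rw [ncard_upperCovers]
    omega
  rw [h3, Finset.card_eq_one]
  simp only [Finset.eq_singleton_iff_unique_mem, Finset.mem_filter, Finset.mem_univ, true_and,
    ExistsUnique]

/-- Any two adjacent positions of `x` with decreasing values give an inversion that some element
covered by `x` lacks. -/
theorem exists_covBy_not_inv {x : WeakB n} {p q : Fin (2 * n)} (hpq : (q : ℕ) = p + 1)
    (h : x.1 q < x.1 p) : ∃ z, z ⋖ x ∧ ¬ Inv z (x.1 q) (x.1 p) := by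
  have main : ∀ i : Fin n, x.1 (right i) < x.1 (left i) →
      ¬ Inv (x.mulSimple i) (x.1 (right i)) (x.1 (left i)) := by
    intro i _ h1
    have h2 := h1.2
    rw [mulSimple_symm, mulSimple_symm, Equiv.symm_apply_apply, Equiv.symm_apply_apply,
      simpleReflection_left, simpleReflection_right] at h2
    exact h2.asymm (left_lt_right i)
  have hq := q.2
  by_cases hp : (p : ℕ) < n
  · have e1 : p = left ⟨p, hp⟩ := rfl
    have e2 : q = right ⟨p, hp⟩ := Fin.ext hpq
    rw [e1, e2] at h ⊢
    exact ⟨_, mulSimple_covBy h, main _ h⟩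
  · have hp' : 2 * n - (p + 2) < n := by omega
    have e1 : p = (right ⟨2 * n - (p + 2), hp'⟩).rev := by
      simp only [right, Fin.ext_iff, Fin.val_rev]; omega
    have e2 : q = (left ⟨2 * n - (p + 2), hp'⟩).rev := by
      simp only [left, Fin.ext_iff, Fin.val_rev]; omega
    rw [e1, e2, x.2, x.2] at h ⊢
    have h' := Fin.rev_lt_rev.1 h
    exact ⟨_, mulSimple_covBy h', fun h1 => main _ h' (by simpa using h1.rev)⟩

/-- A transitive relation that holds between adjacent positions on which a monotone function is
constant holds between any two such positions. -/
theorem rel_of_adjacent {N : ℕ} {α : Type*} [PartialOrder α] {f : Fin N → α} (hf : Monotone f)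
    (r : Fin N → Fin N → Prop) (ht : ∀ p q s, r p q → r q s → r p s)
    (h : ∀ p q : Fin N, (q : ℕ) = p + 1 → f p = f q → r p q) {p q : Fin N} (hpq : p < q)
    (hfpq : f p = f q) : r p q := by
  have main : ∀ (k : ℕ) (q : Fin N), (q : ℕ) = p + 1 + k → f p = f q → r p q := by
    intro k
    induction k with
    | zero => exact fun q hq => h p q hq
    | succ k ih =>
      intro q hq hpq
      have hqN := q.2
      have h1 : f p ≤ f ⟨p + 1 + k, by omega⟩ := hf (Fin.le_def.2 (by simp only; omega))
      have h2 : f ⟨p + 1 + k, by omega⟩ ≤ f q := hf (Fin.le_def.2 (by simp only; omega))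
      have h3 := le_antisymm h1 (hpq ▸ h2)
      exact ht _ _ _ (ih _ rfl h3) (h _ q (by simp only; omega) (h3.symm.trans hpq))
  have := Fin.lt_def.1 hpq
  exact main (q - p - 1) q (by omega) hfpq

/-! ### Stable sorting by an odd sign function -/

/-- A sign function on `Fin (2 * n)` is odd if mirror images receive opposite signs. The signs
`-1, 0, 1` stand for the first, the middle and the last block of a sequence of three blocks, of
which the first and the last are mirror images. -/
def RevOdd (g : Fin (2 * n) → SignType) : Prop := ∀ v, g v.rev = -g v

theorem RevOdd.comp {g : Fin (2 * n) → SignType} (hg : RevOdd g) (x : WeakB n) :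
    RevOdd (g ∘ x.1) := fun v => by
  rw [Function.comp_apply, x.2, hg, Function.comp_apply]

theorem RevOdd.comp_symm {g : Fin (2 * n) → SignType} (hg : RevOdd g) (x : WeakB n) :
    RevOdd (g ∘ x.1.symm) := fun v => by
  rw [Function.comp_apply, symm_rev, hg, Function.comp_apply]

theorem RevOdd.neg {g : Fin (2 * n) → SignType} (hg : RevOdd g) : RevOdd fun v => -g v :=
  fun v => congrArg _ (hg v)

/-- Conjugating the stable sort by the reversal gives a stable sort by the same function, so the two
agree. -/
theorem RevOdd.rev_comp_sort {g : Fin (2 * n) → SignType} (hg : RevOdd g) (i : Fin (2 * n)) :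
    Tuple.sort g i.rev = (Tuple.sort g i).rev := by
  have h : Fin.revPerm.trans ((Tuple.sort g).trans Fin.revPerm) = Tuple.sort g := by
    obtain ⟨h1, h2⟩ := Tuple.eq_sort_iff.1 (rfl : Tuple.sort g = Tuple.sort g)
    refine Tuple.eq_sort_iff.2 ⟨fun p q hpq => ?_, fun p q hpq h => ?_⟩
    · simpa [hg _, SignType.neg_le_neg_iff] using h1 (Fin.rev_le_rev.2 hpq)
    · simp only [Equiv.trans_apply, Fin.revPerm_apply, hg _, neg_inj] at h
      simpa using h2 _ _ (Fin.rev_lt_rev.2 hpq) h.symm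
  have h' := congrArg (fun s : Equiv.Perm (Fin (2 * n)) => (s i).rev) h
  simpa using h'

/-- The element of `B_n` that lists the values in the order of their signs under `g`, and the values
of equal sign in increasing order. -/
def sortOdd (g : Fin (2 * n) → SignType) (hg : RevOdd g) : WeakB n :=
  ⟨Tuple.sort g, hg.rev_comp_sort⟩

/-- The element of `B_n` that lists the values in the order of their signs under `g`, and the values
of equal sign in decreasing order. -/
def revSortOdd (g : Fin (2 * n) → SignType) (hg : RevOdd g) : WeakB n :=
  ⟨(sortOdd _ hg.neg).1.trans Fin.revPerm, fun i => by
    simp [(sortOdd _ hg.neg).2 i]⟩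

theorem monotone_sortOdd {g : Fin (2 * n) → SignType} (hg : RevOdd g) :
    Monotone (g ∘ (sortOdd g hg).1) :=
  Tuple.monotone_sort g

theorem sortOdd_lt {g : Fin (2 * n) → SignType} (hg : RevOdd g) {p q : Fin (2 * n)} (hpq : p < q)
    (h : g ((sortOdd g hg).1 p) = g ((sortOdd g hg).1 q)) :
    (sortOdd g hg).1 p < (sortOdd g hg).1 q :=
  (Tuple.eq_sort_iff.1 (rfl : Tuple.sort g = Tuple.sort g)).2 p q hpq h

theorem apply_revSortOdd {g : Fin (2 * n) → SignType} (hg : RevOdd g) (p : Fin (2 * n)) :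
    g ((revSortOdd g hg).1 p) = -g ((sortOdd _ hg.neg).1 p) :=
  hg _

theorem monotone_revSortOdd {g : Fin (2 * n) → SignType} (hg : RevOdd g) :
    Monotone (g ∘ (revSortOdd g hg).1) := fun p q hpq => by
  rw [Function.comp_apply, Function.comp_apply, apply_revSortOdd hg, apply_revSortOdd hg]
  exact monotone_sortOdd hg.neg hpq

theorem revSortOdd_lt {g : Fin (2 * n) → SignType} (hg : RevOdd g) {p q : Fin (2 * n)}
    (hpq : p < q) (h : g ((revSortOdd g hg).1 p) = g ((revSortOdd g hg).1 q)) :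
    (revSortOdd g hg).1 q < (revSortOdd g hg).1 p := by
  rw [apply_revSortOdd hg, apply_revSortOdd hg] at h
  exact Fin.rev_lt_rev.2 (sortOdd_lt hg.neg hpq h)

theorem inv_sortOdd {g : Fin (2 * n) → SignType} (hg : RevOdd g) {a b : Fin (2 * n)} :
    Inv (sortOdd g hg) a b ↔ a < b ∧ g b < g a := by
  obtain ⟨p, rfl⟩ := (sortOdd g hg).1.surjective a
  obtain ⟨q, rfl⟩ := (sortOdd g hg).1.surjective b
  unfold Inv
  rw [Equiv.symm_apply_apply, Equiv.symm_apply_apply]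
  refine and_congr_right fun h => ⟨fun h1 => ?_, fun h1 => ?_⟩
  · refine lt_of_le_of_ne (monotone_sortOdd hg h1.le) fun h2 => ?_
    exact (sortOdd_lt hg h1 h2).asymm h
  · exact (monotone_sortOdd hg).reflect_lt h1

theorem inv_revSortOdd {g : Fin (2 * n) → SignType} (hg : RevOdd g) {a b : Fin (2 * n)} :
    Inv (revSortOdd g hg) a b ↔ a < b ∧ g b ≤ g a := by
  obtain ⟨p, rfl⟩ := (revSortOdd g hg).1.surjective a
  obtain ⟨q, rfl⟩ := (revSortOdd g hg).1.surjective b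
  unfold Inv
  rw [Equiv.symm_apply_apply, Equiv.symm_apply_apply]
  refine and_congr_right fun h => ⟨fun h1 => monotone_revSortOdd hg h1.le, fun h1 => ?_⟩
  by_contra h2
  have h3 : p < q := lt_of_le_of_ne (not_lt.1 h2) (by rintro rfl; exact h.false)
  exact (revSortOdd_lt hg h3 (le_antisymm (monotone_revSortOdd hg h3.le) h1)).asymm h

/-! ### The image of the pop-stack operator -/

/-- The middle of the sequence is fixed under mirroring, so an increase in its first half starts at
`-1`. -/
theorem RevOdd.apply_left_eq_neg_one {f : Fin (2 * n) → SignType} (hf : RevOdd f)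
    (hm : Monotone f) {i : Fin n} (h : f (left i) < f (right i)) : f (left i) = -1 := by
  have h1 : f (right i) ≤ f (left i).rev := hm (by
    have := i.2
    rw [Fin.le_def, Fin.val_rev]
    simp only [left, right]
    omega)
  rw [hf] at h1
  have hs : ∀ s t : SignType, s < t → t ≤ -s → s = -1 := by decide
  exact hs _ _ h h1

theorem eq_left_or_right_le (i : Fin n) (v : Fin (2 * n)) : v ≤ left i ∨ right i ≤ v := by
  simp only [Fin.le_def, left, right]
  omega

/-- If the order of the blocks is not completely reversed, then listing each block in decreasing
order gives no descent from one block to the next. -/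
theorem apply_eq_of_revSortOdd_lt {g : Fin (2 * n) → SignType} (hg : RevOdd g)
    (ha : ¬ Antitone g) {i : Fin n}
    (hi : (revSortOdd g hg).1 (right i) < (revSortOdd g hg).1 (left i)) :
    g ((revSortOdd g hg).1 (left i)) = g ((revSortOdd g hg).1 (right i)) := by
  set x := revSortOdd g hg with hx
  have hm : Monotone (g ∘ x.1) := monotone_revSortOdd hg
  by_contra hne
  have hlt : g (x.1 (left i)) < g (x.1 (right i)) :=
    lt_of_le_of_ne (hm (left_lt_right i).le) hne
  have hneg : g (x.1 (left i)) = -1 := (hg.comp x).apply_left_eq_neg_one hm hlt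
  rw [hneg] at hlt
  -- The last entry of the first block is its least value.
  have hL : ∀ v, g v = -1 → x.1 (left i) ≤ v := by
    intro v hv
    obtain ⟨q, rfl⟩ := x.1.surjective v
    rcases eq_left_or_right_le i q with h | h
    · rcases h.eq_or_lt with rfl | h
      · exact le_rfl
      · exact (revSortOdd_lt hg h (hv.trans hneg.symm)).le
    · exact absurd hv (hlt.trans_le (hm h)).ne'
  -- The first entry of the next block is its greatest value.
  have hR : ∀ v, g v = g (x.1 (right i)) → v ≤ x.1 (right i) := by
    intro v hv
    obtain ⟨q, rfl⟩ := x.1.surjective v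
    rcases eq_left_or_right_le i q with h | h
    · have h1 : g (x.1 q) ≤ g (x.1 (left i)) := hm h
      rw [hneg, hv] at h1
      exact absurd hlt h1.not_gt
    · rcases h.eq_or_lt with rfl | h
      · exact le_rfl
      · exact (revSortOdd_lt hg h hv.symm).le
  have hno : ∀ v, g v = -1 ∨ g (x.1 (right i)) ≤ g v := by
    intro v
    obtain ⟨q, rfl⟩ := x.1.surjective v
    rcases eq_left_or_right_le i q with h | h
    · have h1 : g (x.1 q) ≤ g (x.1 (left i)) := hm h
      rw [hneg] at h1
      exact Or.inl (le_antisymm h1 (SignType.neg_one_le _))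
    · exact Or.inr (hm h)
  -- So a descent between the blocks, and its mirror image, make `g` antitone.
  refine ha fun a b hab => ?_
  by_contra h
  rw [not_le] at h
  have hs : ∀ s t : SignType, s < t → s = -1 ∨ (s = 0 ∧ t = 1) := by decide
  have hs' : ∀ r t : SignType, -1 < r → r ≤ t → t = r ∨ (t = 1 ∧ r = 0) := by decide
  have hb : g (x.1 (right i)) ≤ g b :=
    (hno b).resolve_left ((SignType.neg_one_le _).trans_lt h).ne'
  have hcases : (g a = -1 ∧ g b = g (x.1 (right i))) ∨
      (g a = -1 ∧ g b = 1 ∧ g (x.1 (right i)) = 0) ∨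
      (g a = 0 ∧ g b = 1 ∧ g (x.1 (right i)) = 0) := by
    rcases hs _ _ h with h1 | ⟨h1, h2⟩
    · rcases hs' _ _ hlt hb with h3 | h3
      · exact Or.inl ⟨h1, h3⟩
      · exact Or.inr (Or.inl ⟨h1, h3⟩)
    · have h3 := (hno a).resolve_left (by rw [h1]; decide)
      have h4 : ∀ r : SignType, -1 < r → r ≤ 0 → r = 0 := by decide
      exact Or.inr (Or.inr ⟨h1, h2, h4 _ hlt (h1 ▸ h3)⟩)
  rcases hcases with ⟨h1, h2⟩ | ⟨h1, h2, h3⟩ | ⟨h1, h2, h3⟩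
  · exact absurd ((hL a h1).trans (hab.trans (hR b h2))) hi.not_ge
  · have h4 := hL b.rev (by rw [hg, h2])
    have h5 := hR (x.1 (right i)).rev (by rw [hg, h3]; rfl)
    have h6 := hL a h1
    simp only [Fin.le_def, Fin.lt_def, Fin.val_rev] at h4 h5 h6 hab hi
    omega
  · have h4 := hL b.rev (by rw [hg, h2])
    have h5 := hR a.rev (by rw [hg, h1, h3]; rfl)
    exact absurd (h4.trans ((Fin.rev_le_rev.2 hab).trans h5)) hi.not_ge

/-- If `g` is not antitone, then the stable sort by `g` is the image under the pop-stack operator of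
the sort by `g` in which every block is reversed. -/
theorem pop_revSortOdd {g : Fin (2 * n) → SignType} (hg : RevOdd g) (ha : ¬ Antitone g) :
    pop (revSortOdd g hg) = sortOdd g hg := by
  set x := revSortOdd g hg with hx
  have hm : Monotone (g ∘ x.1) := monotone_revSortOdd hg
  refine le_antisymm ?_ (le_pop_iff.2 ⟨?_, fun z hz => ?_⟩)
  · obtain ⟨h1, h2⟩ := le_pop_iff.1 (le_refl (pop x))
    generalize pop x = z at h1 h2
    rw [le_iff] at h1 ⊢
    intro a b hab
    obtain ⟨hlt, hle⟩ := (inv_revSortOdd hg).1 (h1 a b hab)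
    refine (inv_sortOdd hg).2 ⟨hlt, lt_of_le_of_ne hle fun heq => ?_⟩
    -- A common lower bound of the elements covered by `x` is increasing on every block.
    have key : ∀ p q, p < q → g (x.1 p) = g (x.1 q) → z.1.symm (x.1 q) < z.1.symm (x.1 p) := by
      intro p q hpq h
      refine rel_of_adjacent (f := g ∘ x.1) hm
        (fun p q => z.1.symm (x.1 q) < z.1.symm (x.1 p)) (fun _ _ _ h3 h4 => h4.trans h3) ?_ hpq h
      intro p q hpq h
      have hlt : x.1 q < x.1 p := revSortOdd_lt hg (Fin.lt_def.2 (by omega)) h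
      obtain ⟨w, hw, hwi⟩ := exists_covBy_not_inv hpq hlt
      have h3 : ¬ Inv z (x.1 q) (x.1 p) := fun h4 => hwi ((le_iff _ _).1 (h2 w hw) _ _ h4)
      rw [inv_iff, not_and, not_not] at h3
      exact h3 hlt
    have h3 := (h1 a b hab).2
    have h4 := key _ _ h3 (by simpa using heq)
    rw [Equiv.apply_symm_apply, Equiv.apply_symm_apply] at h4
    exact h4.asymm hab.2
  · rw [le_iff]
    intro a b hab
    obtain ⟨h1, h2⟩ := (inv_sortOdd hg).1 hab
    exact (inv_revSortOdd hg).2 ⟨h1, h2.le⟩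
  · obtain ⟨i, hi, rfl⟩ := exists_of_covBy hz
    have heq := apply_eq_of_revSortOdd_lt hg ha hi
    -- The inversions lost by removing the descent at `i` lie inside blocks.
    rw [le_iff]
    intro a b hab
    obtain ⟨h1, h2⟩ := (inv_sortOdd hg).1 hab
    rcases inv_mulSimple_of_inv (i := i) ((inv_revSortOdd hg).2 ⟨h1, h2.le⟩) with
      h | ⟨rfl, rfl⟩ | ⟨rfl, rfl⟩
    · exact h
    · exact absurd heq h2.ne
    · rw [hg, hg] at h2
      exact absurd (congrArg _ heq) h2.ne'

/-- If `g` is antitone and not constant, then every element above the stable sort by `g` has a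
descent between two of the blocks, so the stable sort is not an image of the pop-stack operator. -/
theorem sortOdd_notMem_range_pop {g : Fin (2 * n) → SignType} (hg : RevOdd g) (ha : Antitone g)
    (hc : ∃ a b, g a ≠ g b) : sortOdd g hg ∉ Set.range pop := by
  rintro ⟨x, hx⟩
  obtain ⟨h1, h2⟩ := le_pop_iff.1 hx.ge
  have hm : Monotone (g ∘ x.1) := by
    intro p q hpq
    by_contra h
    rw [not_le, Function.comp_apply, Function.comp_apply] at h
    have h3 := ((le_iff _ _).1 h1 _ _ ((inv_sortOdd hg).2 ⟨ha.reflect_lt h, h⟩)).2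
    rw [Equiv.symm_apply_apply, Equiv.symm_apply_apply] at h3
    exact h3.not_ge hpq
  -- A jump of `g` between adjacent positions would be a descent of `x`, and removing it would give
  -- an element covered by `x` but not above the stable sort.
  have hadj : ∀ p q : Fin (2 * n), (q : ℕ) = p + 1 → g (x.1 p) = g (x.1 q) := by
    intro p q hpq
    by_contra hne
    have hlt : g (x.1 p) < g (x.1 q) := lt_of_le_of_ne (hm (Fin.le_def.2 (by omega))) hne
    obtain ⟨z, hz, hzi⟩ := exists_covBy_not_inv hpq (ha.reflect_lt hlt)
    exact hzi ((le_iff _ _).1 (h2 z hz) _ _ ((inv_sortOdd hg).2 ⟨ha.reflect_lt hlt, hlt⟩))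
  have hall : ∀ p q, p < q → g (x.1 p) = g (x.1 q) := fun p q hpq =>
    rel_of_adjacent (f := fun _ => ()) monotone_const (fun p q => g (x.1 p) = g (x.1 q))
      (fun _ _ _ => Eq.trans) (fun p q h _ => hadj p q h) hpq rfl
  obtain ⟨a, b, hab⟩ := hc
  rw [← x.1.apply_symm_apply a, ← x.1.apply_symm_apply b] at hab
  rcases lt_trichotomy (x.1.symm a) (x.1.symm b) with h | h | h
  · exact hab (hall _ _ h)
  · exact hab (by rw [h])
  · exact hab (hall _ _ h).symm

/-! ### Elements with one descent -/

/-- The block structure with first and last blocks of length `k`, as a sign function on the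
positions. -/
def blockSign (n k : ℕ) (p : Fin (2 * n)) : SignType :=
  if (p : ℕ) < k then -1 else if 2 * n ≤ p + k then 1 else 0

theorem blockSign_eq_neg_one_iff {k : ℕ} {p : Fin (2 * n)} :
    blockSign n k p = -1 ↔ (p : ℕ) < k := by
  unfold blockSign
  split_ifs with h1 h2 <;> simp [h1]

theorem blockSign_revOdd {k : ℕ} (hk : k ≤ n) : RevOdd (blockSign n k) := by
  intro p
  have hp := p.2
  unfold blockSign
  rw [Fin.val_rev]
  split_ifs <;> first | omega | simp

theorem blockSign_monotone (n k : ℕ) : Monotone (blockSign n k) := by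
  intro p q hpq
  rw [Fin.le_def] at hpq
  unfold blockSign
  split_ifs <;> first | omega | decide

theorem blockSign_injOn : Set.InjOn (blockSign n) (Set.Iic n) := by
  have main : ∀ k l, k < l → l ≤ n → blockSign n k ≠ blockSign n l := by
    intro k l hkl hl h
    have h1 := congrFun h ⟨k, by omega⟩
    rw [blockSign_eq_neg_one_iff.2 (show ((⟨k, by omega⟩ : Fin (2 * n)) : ℕ) < l from hkl),
      blockSign_eq_neg_one_iff] at h1
    exact h1.false
  intro k hk l hl h
  rcases lt_trichotomy k l with h1 | h1 | h1
  · exact absurd h (main k l h1 hl)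
  · exact h1
  · exact absurd h.symm (main l k h1 hk)

/-- An odd sign function is determined by where its value is `-1`. -/
theorem RevOdd.eq_blockSign {f : Fin (2 * n) → SignType} (hf : RevOdd f) {k : ℕ}
    (h : ∀ p, f p = -1 ↔ (p : ℕ) < k) : f = blockSign n k := by
  funext p
  have hp := p.2
  have h1 := h p
  have h2 := h p.rev
  rw [hf, Fin.val_rev] at h2
  unfold blockSign
  have hs : ∀ s : SignType, s ≠ -1 → -s ≠ -1 → s = 0 := by decide
  split_ifs with h3 h4
  · exact h1.2 h3
  · exact neg_inj.1 (h2.2 (by omega))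
  · exact hs _ (fun h5 => h3 (h1.1 h5)) (fun h5 => h4 (by have := h2.1 h5; omega))

theorem RevOdd.exists_eq_blockSign {f : Fin (2 * n) → SignType} (hf : RevOdd f)
    (hm : Monotone f) : ∃ k ≤ n, f = blockSign n k := by
  have hpos : ∀ p : Fin (2 * n), n ≤ (p : ℕ) → f p ≠ -1 := by
    intro p hp h
    have h1 : f p.rev ≤ f p := hm (by rw [Fin.le_def, Fin.val_rev]; omega)
    rw [hf, h] at h1
    exact absurd h1 (by decide)
  have hex : ∃ k : ℕ, ∀ p : Fin (2 * n), k ≤ (p : ℕ) → f p ≠ -1 := ⟨n, hpos⟩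
  classical
  refine ⟨Nat.find hex, Nat.find_min' hex hpos, hf.eq_blockSign fun p => ⟨fun h => ?_, fun h => ?_⟩⟩
  · by_contra h1
    exact Nat.find_spec hex p (not_lt.1 h1) h
  · have h1 := Nat.find_min hex h
    push Not at h1
    obtain ⟨q, hpq, hq⟩ := h1
    exact le_antisymm (hq ▸ hm (Fin.le_def.2 hpq)) (SignType.neg_one_le _)

/-- The position of a descent of the stable sort by `g` determines the lengths of the blocks. -/
theorem comp_sortOdd_eq_blockSign {g : Fin (2 * n) → SignType} (hg : RevOdd g) {i : Fin n}
    (hi : (sortOdd g hg).1 (right i) < (sortOdd g hg).1 (left i)) :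
    g ∘ (sortOdd g hg).1 = blockSign n (i + 1) := by
  have hm := monotone_sortOdd hg
  have hlt : (g ∘ (sortOdd g hg).1) (left i) < (g ∘ (sortOdd g hg).1) (right i) :=
    lt_of_le_of_ne (hm (left_lt_right i).le) fun h => (sortOdd_lt hg (left_lt_right i) h).asymm hi
  have hneg := (hg.comp _).apply_left_eq_neg_one hm hlt
  refine (hg.comp _).eq_blockSign fun p => ⟨fun h => ?_, fun h => ?_⟩
  · by_contra h1
    have h2 := hm (show right i ≤ p from Fin.le_def.2 (not_lt.1 h1))
    rw [h, ← hneg] at h2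
    exact hlt.not_ge h2
  · exact le_antisymm (hneg ▸ hm (Fin.le_def.2 (Nat.lt_succ_iff.1 h))) (SignType.neg_one_le _)

/-- An element that ascends between any two adjacent positions of the same block, for blocks given
by an odd monotone `f`, is increasing on every block. -/
theorem lt_of_forall_ascent {f : Fin (2 * n) → SignType} (hf : RevOdd f) (hm : Monotone f)
    {x : WeakB n} (h : ∀ i, f (left i) = f (right i) → x.1 (left i) < x.1 (right i))
    {p q : Fin (2 * n)} (hpq : p < q) (hfpq : f p = f q) : x.1 p < x.1 q := by
  refine rel_of_adjacent hm (fun p q => x.1 p < x.1 q) (fun _ _ _ => lt_trans) ?_ hpq hfpq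
  intro p q hpq hfpq
  have hq := q.2
  by_cases hp : (p : ℕ) < n
  · have e1 : p = left ⟨p, hp⟩ := rfl
    have e2 : q = right ⟨p, hp⟩ := Fin.ext hpq
    rw [e1, e2] at hfpq ⊢
    exact h _ hfpq
  · have hp' : 2 * n - (p + 2) < n := by omega
    have e1 : p = (right ⟨2 * n - (p + 2), hp'⟩).rev := by
      simp only [right, Fin.ext_iff, Fin.val_rev]; omega
    have e2 : q = (left ⟨2 * n - (p + 2), hp'⟩).rev := by
      simp only [left, Fin.ext_iff, Fin.val_rev]; omega
    rw [e1, e2, hf, hf, neg_inj] at hfpq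
    rw [e1, e2, x.2, x.2]
    exact Fin.rev_lt_rev.2 (h _ hfpq.symm)

theorem revOdd_zero : RevOdd fun _ : Fin (2 * n) => (0 : SignType) := fun _ => rfl

theorem existsUnique_descent_sortOdd {g : Fin (2 * n) → SignType} (hg : RevOdd g)
    (hm : ¬ Monotone g) :
    ∃! i, (sortOdd g hg).1 (right i) < (sortOdd g hg).1 (left i) := by
  have hex : ∃ i, (sortOdd g hg).1 (right i) < (sortOdd g hg).1 (left i) := by
    by_contra hcon
    push Not at hcon
    -- Without descents the sort is the identity, and `g` was already monotone.
    have hmono : StrictMono (sortOdd g hg).1 := fun p q hpq =>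
      lt_of_forall_ascent revOdd_zero monotone_const (fun i _ => lt_of_le_of_ne (hcon i)
        fun h => (left_lt_right i).ne ((sortOdd g hg).1.injective h)) hpq rfl
    exact hm (Tuple.sort_eq_refl_iff_monotone.1 (perm_eq_of_strictMono _ (Equiv.refl _) hmono))
  obtain ⟨i, hi⟩ := hex
  refine ⟨i, hi, fun j hj => ?_⟩
  have h1 := (comp_sortOdd_eq_blockSign hg hj).symm.trans (comp_sortOdd_eq_blockSign hg hi)
  have h2 := blockSign_injOn (show (j : ℕ) + 1 ≤ n from j.2) (show (i : ℕ) + 1 ≤ n from i.2) h1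
  exact Fin.ext (by omega)

theorem eq_of_sortOdd_eq {g f : Fin (2 * n) → SignType} (hg : RevOdd g) (hf : RevOdd f)
    (hm : ¬ Monotone g) (h : sortOdd g hg = sortOdd f hf) : g = f := by
  obtain ⟨i, hi, -⟩ := existsUnique_descent_sortOdd hg hm
  have h1 := comp_sortOdd_eq_blockSign hg hi
  simp only [h] at hi
  have h2 := comp_sortOdd_eq_blockSign hf hi
  rw [← h2, h] at h1
  exact (sortOdd f hf).1.surjective.injective_comp_right h1

/-- Every element with exactly one descent is a stable sort by a function that is not monotone. -/
theorem exists_sortOdd_eq {x : WeakB n} (hx : ∃! i, x.1 (right i) < x.1 (left i)) :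
    ∃ g, ∃ hg : RevOdd g, ¬ Monotone g ∧ (∃ a b, g a ≠ g b) ∧ sortOdd g hg = x := by
  obtain ⟨i, hi, hu⟩ := hx
  have hk : (i : ℕ) + 1 ≤ n := i.2
  have hb := blockSign_revOdd hk
  have hbm := blockSign_monotone n (i + 1)
  have hL : blockSign n (i + 1) (left i) = -1 := blockSign_eq_neg_one_iff.2 (Nat.lt_succ_self _)
  have hR : blockSign n (i + 1) (right i) ≠ -1 := fun h =>
    (blockSign_eq_neg_one_iff.1 h).false
  have hsort : x.1 = Tuple.sort (blockSign n (i + 1) ∘ x.1.symm) := by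
    refine Tuple.eq_sort_iff.2 ⟨?_, fun p q hpq h => ?_⟩
    · intro p q hpq
      simpa using hbm hpq
    · simp only [Function.comp_apply, Equiv.symm_apply_apply] at h
      refine lt_of_forall_ascent hb hbm (fun j hj => ?_) hpq h
      by_contra h1
      have h2 : x.1 (right j) < x.1 (left j) := lt_of_le_of_ne (not_lt.1 h1) fun h3 =>
        (left_lt_right j).ne (x.1.injective h3).symm
      rw [hu j h2, hL] at hj
      exact hR hj.symm
  refine ⟨blockSign n (i + 1) ∘ x.1.symm, hb.comp_symm x, fun hmono => ?_,
    ⟨x.1 (left i), x.1 (right i), ?_⟩, Subtype.ext hsort.symm⟩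
  · rw [Tuple.sort_eq_refl_iff_monotone.2 hmono] at hsort
    rw [hsort] at hi
    exact (left_lt_right i).asymm hi
  · simp only [Function.comp_apply, Equiv.symm_apply_apply]
    rw [hL]
    exact hR.symm

/-! ### Counting -/

/-- An odd sign function is determined by its values on the first half, which are arbitrary. -/
def revOddEquiv (n : ℕ) : {g : Fin (2 * n) → SignType // RevOdd g} ≃ (Fin n → SignType) where
  toFun g i := g.1 (left i)
  invFun f := ⟨fun v => if h : (v : ℕ) < n then f ⟨v, h⟩ else
    -f ⟨v.rev, by rw [Fin.val_rev]; omega⟩, fun v => by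
      have hv := v.2
      by_cases h : (v : ℕ) < n
      · have h' : ¬ ((v.rev : Fin (2 * n)) : ℕ) < n := by rw [Fin.val_rev]; omega
        simp only [h, h', dite_true, dite_false, Fin.rev_rev]
      · have h' : ((v.rev : Fin (2 * n)) : ℕ) < n := by rw [Fin.val_rev]; omega
        simp only [h, h', dite_true, dite_false, neg_neg]⟩
  left_inv g := by
    apply Subtype.ext
    funext v
    have hv := v.2
    by_cases h : (v : ℕ) < n
    · simp only [h, dite_true]
      rfl
    · have h1 : left ⟨v.rev, by rw [Fin.val_rev]; omega⟩ = v.rev := rfl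
      simp only [h, dite_false, h1]
      rw [g.2, neg_neg]
  right_inv f := by
    funext i
    have h : ((left i : Fin (2 * n)) : ℕ) < n := i.2
    simp only [h, dite_true]
    rfl

theorem ncard_revOdd (n : ℕ) : {g : Fin (2 * n) → SignType | RevOdd g}.ncard = 3 ^ n := by
  refine (Nat.card_coe_set_eq _).symm.trans ((Nat.card_congr (revOddEquiv n)).trans ?_)
  simp [Nat.card_eq_fintype_card, show Fintype.card SignType = 3 from rfl]

/-- The odd monotone sign functions are the block structures with `k = 0, …, n`. -/
theorem ncard_revOdd_monotone (n : ℕ) :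
    {g : Fin (2 * n) → SignType | RevOdd g ∧ Monotone g}.ncard = n + 1 := by
  have h : {g : Fin (2 * n) → SignType | RevOdd g ∧ Monotone g} = blockSign n '' Set.Iic n := by
    ext g
    constructor
    · rintro ⟨h1, h2⟩
      obtain ⟨k, hk, rfl⟩ := h1.exists_eq_blockSign h2
      exact ⟨k, hk, rfl⟩
    · rintro ⟨k, hk, rfl⟩
      exact ⟨blockSign_revOdd hk, blockSign_monotone n _⟩
  rw [h, blockSign_injOn.ncard_image, ← Nat.card_coe_set_eq]
  simp

theorem ncard_revOdd_antitone (n : ℕ) :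
    {g : Fin (2 * n) → SignType | RevOdd g ∧ Antitone g}.ncard = n + 1 := by
  have h : {g : Fin (2 * n) → SignType | RevOdd g ∧ Antitone g} =
      (fun g v => -g v) '' {g : Fin (2 * n) → SignType | RevOdd g ∧ Monotone g} := by
    have hs : ∀ s t : SignType, s ≤ t → -t ≤ -s := by decide
    ext g
    constructor
    · rintro ⟨h1, h2⟩
      exact ⟨fun v => -g v, ⟨h1.neg, fun a b hab => hs _ _ (h2 hab)⟩, funext fun v => neg_neg _⟩
    · rintro ⟨f, ⟨h1, h2⟩, rfl⟩
      exact ⟨h1.neg, fun a b hab => hs _ _ (h2 hab)⟩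
  rw [h, Set.ncard_image_of_injective, ncard_revOdd_monotone]
  exact fun f g hfg => funext fun v => neg_inj.1 (congrFun hfg v)

theorem revOdd_monotone_inter_antitone (n : ℕ) :
    {g : Fin (2 * n) → SignType | RevOdd g ∧ Monotone g} ∩ {g | RevOdd g ∧ Antitone g} =
      {fun _ => 0} := by
  ext g
  simp only [Set.mem_inter_iff, Set.mem_ofPred_eq, Set.mem_singleton_iff]
  constructor
  · rintro ⟨⟨h1, h2⟩, -, h3⟩
    funext v
    have hs : ∀ s : SignType, s = -s → s = 0 := by decide
    refine hs _ ?_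
    rw [← h1]
    rcases le_total v v.rev with h | h
    · exact le_antisymm (h2 h) (h3 h)
    · exact le_antisymm (h3 h) (h2 h)
  · rintro rfl
    exact ⟨⟨revOdd_zero, monotone_const⟩, revOdd_zero, antitone_const⟩

theorem ncard_revOdd_not_monotone_not_antitone (n : ℕ) :
    {g : Fin (2 * n) → SignType | RevOdd g ∧ ¬ Monotone g ∧ ¬ Antitone g}.ncard + (2 * n + 1) =
      3 ^ n := by
  have h1 := Set.ncard_union_add_ncard_inter {g : Fin (2 * n) → SignType | RevOdd g ∧ Monotone g}
    {g | RevOdd g ∧ Antitone g}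
  rw [revOdd_monotone_inter_antitone, Set.ncard_singleton, ncard_revOdd_monotone,
    ncard_revOdd_antitone] at h1
  have h2 : {g : Fin (2 * n) → SignType | RevOdd g ∧ ¬ Monotone g ∧ ¬ Antitone g} =
      {g | RevOdd g} \ ({g | RevOdd g ∧ Monotone g} ∪ {g | RevOdd g ∧ Antitone g}) := by
    ext g
    simp only [Set.mem_ofPred_eq, Set.mem_sdiff, Set.mem_union]
    tauto
  have h3 := Set.ncard_sdiff_add_ncard_of_subset
    (show {g : Fin (2 * n) → SignType | RevOdd g ∧ Monotone g} ∪ {g | RevOdd g ∧ Antitone g} ⊆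
      {g | RevOdd g} from Set.union_subset (fun _ h => h.1) (fun _ h => h.1))
  rw [ncard_revOdd, ← h2] at h3
  omega

theorem ncard_range_pop_upperCovers (hn : 1 ≤ n) :
    {x : WeakB n | x ∈ Set.range (pop : WeakB n → WeakB n) ∧
      (upperCovers x).ncard = n - 1}.ncard + (2 * n + 1) = 3 ^ n := by
  rw [← ncard_revOdd_not_monotone_not_antitone]
  congr 1
  symm
  refine Set.ncard_congr (fun g hg => sortOdd g hg.1) ?_ ?_ ?_
  · rintro g ⟨hg, hm, ha⟩
    exact ⟨⟨_, pop_revSortOdd hg ha⟩, (ncard_upperCovers_eq_sub_one_iff hn _).2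
      (existsUnique_descent_sortOdd hg hm)⟩
  · intro g f hg hf h
    exact eq_of_sortOdd_eq hg.1 hf.1 hg.2.1 h
  · rintro x ⟨hx, hc⟩
    obtain ⟨g, hg, hm, hne, rfl⟩ :=
      exists_sortOdd_eq ((ncard_upperCovers_eq_sub_one_iff hn _).1 hc)
    exact ⟨g, ⟨hg, hm, fun ha => sortOdd_notMem_range_pop hg ha hne hx⟩, rfl⟩

end WeakB

theorem coeff_popPolynomial {M : Type*} [SemilatticeInf M] [Fintype M] (k : ℕ) :
    (popPolynomial M).coeff k =
      ({x : M | x ∈ Set.range (pop : M → M) ∧ (upperCovers x).ncard = k}.ncard : ℤ) := by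
  classical
  have h : {x : M | x ∈ Set.range (pop : M → M) ∧ (upperCovers x).ncard = k} =
      ↑((Finset.univ.image (pop : M → M)).filter fun x => k = (upperCovers x).ncard) := by
    ext x
    simp [eq_comm]
  rw [h, Set.ncard_coe_finset, popPolynomial, Polynomial.finsetSum_coeff]
  simp only [Polynomial.coeff_X_pow, Finset.sum_boole]

end PopStack

theorem mainTheorem1 (n : ℕ) (hn : 1 ≤ n) :
    (PopStack.popPolynomial (PopStack.WeakB n)).coeff (n - 1) = 3 ^ n - 2 * (n : ℤ) - 1 ∧
    (({x : PopStack.WeakB n | x ∈ Set.range (PopStack.pop : PopStack.WeakB n → PopStack.WeakB n) ∧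
        (PopStack.upperCovers x).ncard = n - 1}.ncard : ℕ) : ℤ) = 3 ^ n - 2 * (n : ℤ) - 1 := by
  have h : (({x : PopStack.WeakB n |
      x ∈ Set.range (PopStack.pop : PopStack.WeakB n → PopStack.WeakB n) ∧
        (PopStack.upperCovers x).ncard = n - 1}.ncard : ℕ) : ℤ) = 3 ^ n - 2 * (n : ℤ) - 1 := by
    have h1 := congrArg (Nat.cast : ℕ → ℤ) (PopStack.WeakB.ncard_range_pop_upperCovers hn)
    push_cast at h1
    linarith
  exact ⟨(PopStack.coeff_popPolynomial (n - 1)).trans h, h⟩
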